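/- Let $M$ be a smooth manifold modelled on an infinite-dimensional convenient vector space $E$ over $\mathbb{R}$ (a Hausdorff locally convex topological vector space in which every smooth curve has a smooth antiderivative; a map between open subsets of such spaces is smooth if it takes smooth curves to smooth curves). Let $\eta\in\Omega^1(M)$ be a smooth 1-form on the (kinematic) tangent bundle $TM$, and put $\mathrm{Hor}_p=\ker\eta_p\subset T_pM$ and $\mathrm{Ver}_p=\{v\in T_pM : d\eta_p(v,\cdot)=0\}$ for $p\in M$. Assume that $(M,\eta)$ is a contact manifold, that is, $d\eta$ is degenerate at every point ($\mathrm{Ver}_p\neq\{0\}$ for all $p\in M$) and $T_pM=\mathrm{Hor}_p\oplus\mathrm{Ver}_p$ for all $p\in M$. Then for every integer $k\geq 0$ the $(2k+1)$-form $\eta\wedge(d\eta)^k$ vanishes at no point of $M$, i.e. $$\bigl(\eta\wedge(d\eta)^k\bigr)_p\neq 0\quad\text{for all } k\in\mathbb{N}\text{ and all } p\in M.$$ -/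

import Mathlib

open Filter Set Topology
open scoped ContDiff

namespace ConvenientGeometry

theorem contDiff_bump_series (χ : ℝ → ℝ) (hχ : ContDiff ℝ ∞ χ) (hc : HasCompactSupport χ)
    (m a t : ℕ → ℝ) (hs : ∀ k : ℕ, Summable fun n => |m n| * |a n| ^ k) :
    ContDiff ℝ ∞ fun s => ∑' n, m n * χ (a n * (s - t n)) := by
  have hb : ∀ k : ℕ, ∃ C, ∀ x, ‖iteratedDeriv k χ x‖ ≤ C := by
    intro k
    apply Continuous.bounded_above_of_compact_support
    · exact hχ.continuous_iteratedDeriv k (by exact_mod_cast le_top)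
    · have := hc.iteratedFDeriv (𝕜 := ℝ) k
      rw [iteratedDeriv_eq_equiv_comp]
      exact this.comp_left (by simp)
  choose C hC using hb
  refine contDiff_tsum (N := ⊤) (v := fun k n => |m n| * |a n| ^ k * C k) ?_ ?_ ?_
  · intro n; fun_prop
  · intro k _; exact (hs k).mul_right _
  · intro k n x _
    rw [norm_iteratedFDeriv_eq_norm_iteratedDeriv]
    have h1 : iteratedDeriv k (fun s => m n * χ (a n * (s - t n))) x
        = m n * (a n ^ k * iteratedDeriv k χ (a n * (x - t n))) := by
      rw [iteratedDeriv_const_mul_field]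
      have := congrFun (iteratedDeriv_comp_sub_const k (fun y => χ (a n * y)) (t n)) x
      rw [this, iteratedDeriv_comp_const_mul (hχ.of_le (by exact_mod_cast le_top))]
    rw [h1, norm_mul, norm_mul, norm_pow, Real.norm_eq_abs, Real.norm_eq_abs, mul_assoc]
    gcongr
    exact hC k _

theorem second_difference_bound (G : ℝ → ℝ) (hG : ContDiff ℝ ∞ G) :
    ∃ C, ∀ t ∈ Icc (0 : ℝ) 1, ∀ s ∈ Ioc (0 : ℝ) 1,
      |G (t + s) + G (t - s) - 2 * G t| ≤ C * s ^ 2 := by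
  have h1 : Differentiable ℝ G := hG.differentiable (by simp)
  have hd : ContDiff ℝ ∞ (deriv G) := (contDiff_infty_iff_deriv.1 hG).2
  have h2 : Differentiable ℝ (deriv G) := hd.differentiable (by simp)
  have h3 : Continuous (deriv (deriv G)) := ((contDiff_infty_iff_deriv.1 hd).2).continuous
  obtain ⟨C, hC⟩ := (isCompact_Icc (a := (-1 : ℝ)) (b := 2)).exists_bound_of_continuousOn
    h3.continuousOn
  refine ⟨2 * C, fun t ht s hs => ?_⟩
  obtain ⟨u, hu, hu'⟩ := exists_deriv_eq_slope G (a := t) (b := t + s) (by linarith [hs.1])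
    h1.continuous.continuousOn h1.differentiableOn
  obtain ⟨v, hv, hv'⟩ := exists_deriv_eq_slope G (a := t - s) (b := t) (by linarith [hs.1])
    h1.continuous.continuousOn h1.differentiableOn
  have hl := (convex_Icc (-1 : ℝ) 2).norm_image_sub_le_of_norm_deriv_le
    (f := deriv G) (C := C) (fun x _ => h2 x) hC (x := v) (y := u)
    ⟨by linarith [hv.1, ht.1, hs.2], by linarith [hv.2, ht.2]⟩
    ⟨by linarith [hu.1, ht.1], by linarith [hu.2, ht.2, hs.2]⟩
  have hs0 : s ≠ 0 := hs.1.ne'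
  have e1 : G (t + s) - G t = s * deriv G u := by rw [hu', add_sub_cancel_left]; field_simp
  have e2 : G t - G (t - s) = s * deriv G v := by rw [hv', sub_sub_cancel]; field_simp
  have e3 : G (t + s) + G (t - s) - 2 * G t = s * (deriv G u - deriv G v) := by linarith
  have hC0 : 0 ≤ C := (norm_nonneg _).trans (hC 0 (by norm_num))
  rw [e3, abs_mul, abs_of_pos hs.1]
  have huv : ‖u - v‖ ≤ 2 * s := by
    rw [Real.norm_eq_abs, abs_le]; constructor <;> linarith [hu.1, hu.2, hv.1, hv.2]
  have : |deriv G u - deriv G v| ≤ C * (2 * s) := hl.trans (by gcongr)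
  nlinarith [hs.1]

theorem summable_gauss (k : ℕ) :
    Summable fun n : ℕ => (1 / 2 : ℝ) ^ (n ^ 2) * (4 * 2 ^ n) ^ k := by
  refine Summable.of_nonneg_of_le (fun n => by positivity) (fun n => ?_)
    ((summable_geometric_two).mul_left (4 ^ k * 2 ^ ((k + 1) ^ 2)))
  have h : (2 : ℝ) ^ (n * k + n) ≤ 2 ^ ((k + 1) ^ 2 + n ^ 2) :=
    pow_le_pow_right₀ (by norm_num) (by nlinarith [sq_nonneg ((n : ℤ) - k - 1)])
  rw [mul_pow, ← pow_mul, one_div, inv_pow, inv_pow]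
  rw [pow_add, pow_add] at h
  field_simp
  nlinarith [pow_pos (show (0:ℝ) < 4 by norm_num) k]

theorem deriv_diag_of_smooth_along_curves (F : ℝ → ℝ → ℝ)
    (hF : ∀ g h : ℝ → ℝ, ContDiff ℝ ∞ g → ContDiff ℝ ∞ h → ContDiff ℝ ∞ fun t => F (g t) (h t)) :
    deriv (fun t => F t t) 0 = deriv (fun t => F t 0) 0 + deriv (fun t => F 0 t) 0 := by
  -- first order expansion along the three rays
  have hd1 := ((hF _ _ contDiff_id contDiff_id).differentiable (by simp) 0).hasDerivAt
  have hd2 := ((hF _ _ contDiff_id (contDiff_const (c := 0))).differentiable (by simp) 0).hasDerivAt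
  have hd3 := ((hF _ _ (contDiff_const (c := 0)) contDiff_id).differentiable (by simp) 0).hasDerivAt
  simp only [id] at hd1 hd2 hd3
  set D := deriv (fun t => F t t) 0
  set D1 := deriv (fun t => F t 0) 0
  set D2 := deriv (fun t => F 0 t) 0
  let r : ℕ → ℝ := fun n => (1 / 8) ^ (n ^ 2)
  let s : ℕ → ℝ := fun n => (1 / 4) ^ (n ^ 2)
  let t : ℕ → ℝ := fun n => (1 / 2) ^ n
  let a : ℕ → ℝ := fun n => 4 * 2 ^ n
  have hsq : Tendsto (fun n : ℕ => n ^ 2) atTop atTop := tendsto_pow_atTop (by norm_num)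
  have hr0 : Tendsto r atTop (𝓝 0) :=
    (tendsto_pow_atTop_nhds_zero_of_lt_one (by norm_num) (by norm_num)).comp hsq
  have hrp : ∀ n, 0 < r n := fun n => by positivity
  have hsp : ∀ n, 0 < s n := fun n => by positivity
  have hlim : Tendsto (fun n => (F (r n) 0 + F 0 (r n) - 2 * F (r n / 2) (r n / 2)) / r n)
      atTop (𝓝 (D1 + D2 - D)) := by
    have hr0' : Tendsto r atTop (𝓝[≠] 0) :=
      tendsto_nhdsWithin_iff.2 ⟨hr0, Eventually.of_forall fun n => (hrp n).ne'⟩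
    have hr2' : Tendsto (fun n => r n / 2) atTop (𝓝[≠] 0) :=
      tendsto_nhdsWithin_iff.2 ⟨by simpa using hr0.div_const 2,
        Eventually.of_forall fun n => (half_pos (hrp n)).ne'⟩
    have l1 := (hasDerivAt_iff_tendsto_slope_zero.1 hd2).comp hr0'
    have l2 := (hasDerivAt_iff_tendsto_slope_zero.1 hd3).comp hr0'
    have l3 := (hasDerivAt_iff_tendsto_slope_zero.1 hd1).comp hr2'
    refine ((l1.add l2).sub l3).congr fun n => ?_
    have := (hrp n).ne'
    simp only [Function.comp, zero_add, smul_eq_mul]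
    field_simp
    ring
  -- the curve
  let χ : ContDiffBump (0 : ℝ) := ⟨1 / 2, 1, by norm_num, by norm_num⟩
  have hχ : ContDiff ℝ ∞ χ := χ.contDiff
  have hχc : HasCompactSupport χ := χ.hasCompactSupport
  have hχ1 : ContDiff ℝ ∞ fun x => x * χ x := contDiff_id.mul hχ
  have hχ1c : HasCompactSupport fun x => x * χ x := hχc.mul_left
  have ha : ∀ n, 0 < a n := fun n => by positivity
  have ha1 : ∀ n, 1 ≤ a n := fun n => by
    have : (1 : ℝ) ≤ 2 ^ n := one_le_pow₀ (by norm_num)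
    simp only [a]; linarith
  have hrs : ∀ n, r n = (1 / 2) ^ (n ^ 2) * s n := fun n => by
    simp only [r, s, ← mul_pow]; norm_num
  have hs1 : ∀ n, s n ≤ 1 := fun n => pow_le_one₀ (by norm_num) (by norm_num)
  have hsum1 : ∀ k, Summable fun n => |r n / 2| * |a n| ^ k := fun k => by
    refine Summable.of_nonneg_of_le (fun n => by positivity) (fun n => ?_) (summable_gauss k)
    rw [abs_of_pos (half_pos (hrp n)), abs_of_pos (ha n)]
    have : r n / 2 ≤ (1 / 2) ^ (n ^ 2) := by
      rw [hrs]
      have : (0 : ℝ) < (1 / 2) ^ (n ^ 2) := by positivity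
      nlinarith [hs1 n, hsp n]
    gcongr
  have hsum2 : ∀ k, Summable fun n => |(1 / 2) ^ (n ^ 2) / (2 * a n)| * |a n| ^ k := fun k => by
    refine Summable.of_nonneg_of_le (fun n => by positivity) (fun n => ?_) (summable_gauss k)
    have ha' := ha n
    rw [abs_of_pos (by positivity), abs_of_pos (ha n)]
    have : (1 / 2 : ℝ) ^ (n ^ 2) / (2 * a n) ≤ (1 / 2) ^ (n ^ 2) :=
      div_le_self (by positivity) (by linarith [ha1 n])
    gcongr
  let P : ℝ → ℝ := fun x => ∑' n, r n / 2 * χ (a n * (x - t n))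
  let Q : ℝ → ℝ := fun x => ∑' n, (1 / 2) ^ (n ^ 2) / (2 * a n) *
    ((a n * (x - t n)) * χ (a n * (x - t n)))
  have hP : ContDiff ℝ ∞ P := contDiff_bump_series _ hχ hχc _ _ _ hsum1
  have hQ : ContDiff ℝ ∞ Q := contDiff_bump_series _ hχ1 hχ1c _ _ _ hsum2
  -- only one bump is active near `t n`
  have hsmall : ∀ n, 2 ≤ n → a n * s n ≤ 1 / 16 := fun n hn => by
    have h1 : s n ≤ (1 / 4) ^ (2 * n) :=
      pow_le_pow_of_le_one (by norm_num) (by norm_num) (by nlinarith)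
    have h2 : ((1 / 8 : ℝ)) ^ n ≤ (1 / 8) ^ 2 :=
      pow_le_pow_of_le_one (by norm_num) (by norm_num) hn
    calc a n * s n ≤ a n * (1 / 4) ^ (2 * n) := by have := (ha n).le; gcongr
      _ = 4 * (1 / 8) ^ n := by
        simp only [a]; rw [pow_mul, mul_assoc, ← mul_pow]; norm_num
      _ ≤ 1 / 16 := by norm_num at h2 ⊢; linarith
  have hat : ∀ n, a n * t n = 4 := fun n => by
    simp only [a, t]; rw [mul_assoc, ← mul_pow]; norm_num
  have hone : ∀ n, 2 ≤ n → ∀ x, |x - t n| ≤ s n → χ (a n * (x - t n)) = 1 := by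
    intro n hn x hx
    apply χ.one_of_mem_closedBall
    rw [mem_closedBall_zero_iff, Real.norm_eq_abs, abs_mul, abs_of_pos (ha n)]
    have := mul_le_mul_of_nonneg_left hx (ha n).le
    show _ ≤ (1 / 2 : ℝ)
    linarith [hsmall n hn]
  have hzero : ∀ n, 2 ≤ n → ∀ x, |x - t n| ≤ s n → ∀ j, j ≠ n → χ (a j * (x - t j)) = 0 := by
    intro n hn x hx j hj
    apply χ.zero_of_le_dist
    rw [dist_zero_right, Real.norm_eq_abs, abs_mul, abs_of_pos (ha j)]
    show (1 : ℝ) ≤ _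
    have hx' := abs_le.1 hx
    have hk := hsmall n hn
    rcases lt_or_gt_of_ne hj with h | h
    · have h1 : t n ≤ t j / 2 := by
        have : t n ≤ (1 / 2) ^ (j + 1) := pow_le_pow_of_le_one (by norm_num) (by norm_num) h
        simp only [t] at this ⊢; rw [pow_succ] at this; linarith
      have h2 : a j ≤ a n := by
        simp only [a]; gcongr; norm_num
      have h3 : a j * s n ≤ 1 / 16 := (mul_le_mul_of_nonneg_right h2 (hsp n).le).trans hk
      have h4 : -(x - t j) ≤ |x - t j| := neg_le_abs _
      have h5 : t j / 2 - s n ≤ |x - t j| := by linarith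
      have := mul_le_mul_of_nonneg_left h5 (ha j).le
      have := hat j
      nlinarith
    · have h1 : t j ≤ t n / 2 := by
        have : t j ≤ (1 / 2) ^ (n + 1) := pow_le_pow_of_le_one (by norm_num) (by norm_num) h
        simp only [t] at this ⊢; rw [pow_succ] at this; linarith
      have h2 : a n ≤ a j := by
        simp only [a]; gcongr; norm_num
      have h4 : (x - t j) ≤ |x - t j| := le_abs_self _
      have h5 : t n / 2 - s n ≤ |x - t j| := by linarith
      have h6 := mul_le_mul_of_nonneg_left h5 (ha n).le
      have h7 := mul_le_mul_of_nonneg_right h2 (abs_nonneg (x - t j))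
      have := hat n
      nlinarith
  have hPv : ∀ n, 2 ≤ n → ∀ x, |x - t n| ≤ s n → P x = r n / 2 := by
    intro n hn x hx
    simp only [P]
    rw [tsum_eq_single n fun j hj => by rw [hzero n hn x hx j hj, mul_zero], hone n hn x hx,
      mul_one]
  have hQv : ∀ n, 2 ≤ n → ∀ x, |x - t n| ≤ s n → Q x = r n / (2 * s n) * (x - t n) := by
    intro n hn x hx
    simp only [Q]
    rw [tsum_eq_single n fun j hj => by rw [hzero n hn x hx j hj, mul_zero, mul_zero],
      hone n hn x hx, mul_one, hrs]
    have := (ha n).ne'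
    have := (hsp n).ne'
    field_simp
  obtain ⟨C, hC⟩ := second_difference_bound _ (hF _ _ (hP.add hQ) (hP.sub hQ))
  have hlim0 : Tendsto (fun n => (F (r n) 0 + F 0 (r n) - 2 * F (r n / 2) (r n / 2)) / r n)
      atTop (𝓝 0) := by
    have hz : Tendsto (fun n : ℕ => C * (1 / 2 : ℝ) ^ (n ^ 2)) atTop (𝓝 0) := by
      simpa using ((tendsto_pow_atTop_nhds_zero_of_lt_one (r := (1 / 2 : ℝ)) (by norm_num)
        (by norm_num)).comp hsq).const_mul C
    refine squeeze_zero_norm' ?_ hz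
    filter_upwards [eventually_ge_atTop 2] with n hn
    have hsn := hsp n
    have key := hC (t n) ⟨by positivity, pow_le_one₀ (by norm_num) (by norm_num)⟩ (s n)
      ⟨hsp n, hs1 n⟩
    have A1 : |t n + s n - t n| ≤ s n := by simp [abs_of_pos hsn]
    have A2 : |t n - s n - t n| ≤ s n := by simp [abs_of_pos hsn]
    have A3 : |t n - t n| ≤ s n := by simpa using hsn.le
    have w1 : r n / (2 * s n) * (t n + s n - t n) = r n / 2 := by field_simp; ring
    have w2 : r n / (2 * s n) * (t n - s n - t n) = - (r n / 2) := by field_simp; ring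
    simp only [hPv n hn _ A1, hPv n hn _ A2, hPv n hn _ A3, hQv n hn _ A1, hQv n hn _ A2,
      hQv n hn _ A3, w1, w2] at key
    simp only [add_halves, sub_self, mul_zero, add_zero, sub_zero, add_neg_cancel, sub_neg_eq_add]
      at key
    rw [Real.norm_eq_abs, abs_div, abs_of_pos (hrp n), div_le_iff₀ (hrp n)]
    calc _ ≤ C * s n ^ 2 := key
      _ = _ := by
        have : s n = (1 / 2) ^ (n ^ 2) * (1 / 2) ^ (n ^ 2) := by
          simp only [s, ← mul_pow]; norm_num
        rw [hrs]
        rw [mul_assoc, ← mul_assoc ((1 / 2 : ℝ) ^ (n ^ 2)), ← this, pow_two]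
  have := tendsto_nhds_unique hlim hlim0
  linarith

section Curves

variable {E F : Type*} [AddCommGroup E] [Module ℝ E] [TopologicalSpace E]
  [AddCommGroup F] [Module ℝ F] [TopologicalSpace F]

/-- `v = lim_{δ → 0} (c (t + δ) - c t) / δ`, the limit being taken in the topology of `E`. -/
def HasCurveDerivAt (c : ℝ → E) (v : E) (t : ℝ) : Prop :=
  Tendsto (fun δ : ℝ => δ⁻¹ • (c (t + δ) - c t)) (𝓝[≠] 0) (𝓝 v)

open Classical in
/-- The derivative `c' t` of a curve (with the value `0` where the curve is not
differentiable). -/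
noncomputable def curveDeriv (c : ℝ → E) (t : ℝ) : E :=
  if h : ∃ v, HasCurveDerivAt c v t then h.choose else 0

/-- `c` is smooth on the open set of times `J`: all iterated derivatives exist and are
continuous there. -/
def SmoothCurveOn (c : ℝ → E) (J : Set ℝ) : Prop :=
  ∀ n : ℕ, ContinuousOn (curveDeriv^[n] c) J ∧
    ∀ t ∈ J, ∃ v, HasCurveDerivAt (curveDeriv^[n] c) v t

/-- The smooth curves `ℝ → E`. -/
def SmoothCurve (c : ℝ → E) : Prop := SmoothCurveOn c univ

/-- A map defined on an open subset `U` of `E` is smooth if it maps smooth curves in `U` to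
smooth curves. -/
def SmoothMapOn (f : E → F) (U : Set E) : Prop :=
  ∀ c : ℝ → E, SmoothCurve c → (∀ t, c t ∈ U) → SmoothCurve (f ∘ c)

/-- A (Hausdorff, locally convex) topological vector space is convenient if each smooth curve
has a smooth antiderivative. -/
class ConvenientSpace (E : Type*) [AddCommGroup E] [Module ℝ E] [TopologicalSpace E]
    [IsTopologicalAddGroup E] [ContinuousSMul ℝ E] [LocallyConvexSpace ℝ E] [T2Space E] :
    Prop where
  exists_antideriv : ∀ c : ℝ → E, SmoothCurve c →
    ∃ b : ℝ → E, SmoothCurve b ∧ ∀ t, HasCurveDerivAt b (c t) t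

theorem HasCurveDerivAt.curveDeriv_eq [T2Space E] {c : ℝ → E} {v : E} {t : ℝ}
    (h : HasCurveDerivAt c v t) : curveDeriv c t = v := by
  have hex : ∃ v, HasCurveDerivAt c v t := ⟨v, h⟩
  rw [curveDeriv, dif_pos hex]
  exact tendsto_nhds_unique hex.choose_spec h

theorem HasCurveDerivAt.congr {c b : ℝ → E} {v : E} {t : ℝ} (h : HasCurveDerivAt c v t)
    (e : c =ᶠ[𝓝 t] b) : HasCurveDerivAt b v t := by
  refine Tendsto.congr' ?_ h
  have ht : Tendsto (fun δ : ℝ => t + δ) (𝓝[≠] 0) (𝓝 t) := by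
    have : Tendsto (fun δ : ℝ => t + δ) (𝓝 0) (𝓝 (t + 0)) :=
      (continuous_const.add continuous_id).tendsto _
    rw [add_zero] at this
    exact this.mono_left nhdsWithin_le_nhds
  filter_upwards [ht.eventually e] with δ hδ
  rw [hδ, e.self_of_nhds]

open Classical in
theorem curveDeriv_congr {c b : ℝ → E} {t : ℝ} (e : c =ᶠ[𝓝 t] b) :
    curveDeriv c t = curveDeriv b t := by
  have key : ∀ P Q : E → Prop, P = Q →
      (if h : ∃ v, P v then h.choose else 0) = if h : ∃ v, Q v then h.choose else (0 : E) := by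
    rintro P _ rfl; rfl
  have h : (fun v => HasCurveDerivAt c v t) = fun v => HasCurveDerivAt b v t := by
    funext v
    exact propext ⟨fun h => h.congr e, fun h => h.congr e.symm⟩
  exact key _ _ h

theorem curveDeriv_iterate_congr {c b : ℝ → E} {t : ℝ} (e : c =ᶠ[𝓝 t] b) (n : ℕ) :
    curveDeriv^[n] c =ᶠ[𝓝 t] curveDeriv^[n] b := by
  induction n with
  | zero => exact e
  | succ n ih =>
    rw [Function.iterate_succ_apply', Function.iterate_succ_apply']
    filter_upwards [ih.eventually_nhds] with s hs
    exact curveDeriv_congr hs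

/-- Smoothness of a curve is a local property. -/
theorem smoothCurveOn_of_local {c : ℝ → E} {J : Set ℝ}
    (h : ∀ t ∈ J, ∃ b, SmoothCurve b ∧ c =ᶠ[𝓝 t] b) : SmoothCurveOn c J := by
  intro n
  refine ⟨fun t ht => ?_, fun t ht => ?_⟩ <;> obtain ⟨b, hb, e⟩ := h t ht
  · refine ContinuousAt.continuousWithinAt ?_
    exact (((hb n).1 t (mem_univ t)).continuousAt univ_mem).congr
      (curveDeriv_iterate_congr e n).symm
  · obtain ⟨v, hv⟩ := (hb n).2 t (mem_univ t)
    exact ⟨v, hv.congr (curveDeriv_iterate_congr e n).symm⟩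

theorem hasCurveDerivAt_real_iff {c : ℝ → ℝ} {v t : ℝ} :
    HasCurveDerivAt c v t ↔ HasDerivAt c v t :=
  hasDerivAt_iff_tendsto_slope_zero.symm

theorem curveDeriv_real : (curveDeriv : (ℝ → ℝ) → ℝ → ℝ) = deriv := by
  funext c t
  by_cases h : ∃ v, HasCurveDerivAt c v t
  · obtain ⟨v, hv⟩ := h
    rw [hv.curveDeriv_eq, (hasCurveDerivAt_real_iff.1 hv).deriv]
  · rw [curveDeriv, dif_neg h, deriv_zero_of_not_differentiableAt]
    exact fun hd => h ⟨_, hasCurveDerivAt_real_iff.2 hd.hasDerivAt⟩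

theorem smoothCurve_real_iff {c : ℝ → ℝ} : SmoothCurve c ↔ ContDiff ℝ ∞ c := by
  constructor
  · intro h
    refine contDiff_of_differentiable_iteratedDeriv (n := ⊤) fun m _ t => ?_
    obtain ⟨v, hv⟩ := (h m).2 t (mem_univ t)
    rw [curveDeriv_real] at hv
    rw [iteratedDeriv_eq_iterate]
    exact (hasCurveDerivAt_real_iff.1 hv).differentiableAt
  · intro h n
    have hn : ContDiff ℝ ∞ (curveDeriv^[n] c) := by
      rw [curveDeriv_real]; exact h.iterate_deriv n
    exact ⟨hn.continuous.continuousOn, fun t _ => ⟨_, hasCurveDerivAt_real_iff.2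
      (hn.differentiable (by simp) t).hasDerivAt⟩⟩

variable [IsTopologicalAddGroup E] [ContinuousSMul ℝ E]

theorem hasCurveDerivAt_plane (x v w : E) {g h : ℝ → ℝ} {t : ℝ} (hg : DifferentiableAt ℝ g t)
    (hh : DifferentiableAt ℝ h t) :
    HasCurveDerivAt (fun s => x + g s • v + h s • w) (deriv g t • v + deriv h t • w) t := by
  have l1 := (hasDerivAt_iff_tendsto_slope_zero.1 hg.hasDerivAt).smul_const v
  have l2 := (hasDerivAt_iff_tendsto_slope_zero.1 hh.hasDerivAt).smul_const w
  refine (l1.add l2).congr fun δ => ?_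
  simp only [smul_eq_mul]
  module

/-- Small plane patches through a point of an open set stay in the open set. -/
theorem exists_plane_subset {U : Set E} (hU : IsOpen U) {x : E} (hx : x ∈ U) (v w : E) :
    ∃ ε > 0, ∀ s t : ℝ, |s| < ε → |t| < ε → x + s • v + t • w ∈ U := by
  have hc : Continuous fun p : ℝ × ℝ => x + p.1 • v + p.2 • w := by fun_prop
  have hm : (fun p : ℝ × ℝ => x + p.1 • v + p.2 • w) ⁻¹' U ∈ 𝓝 (0 : ℝ × ℝ) :=
    (hU.preimage hc).mem_nhds (by simpa using hx)
  obtain ⟨ε, hε, h⟩ := Metric.mem_nhds_iff.1 hm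
  refine ⟨ε, hε, fun s t hs ht => @h (s, t) ?_⟩
  simp [Prod.norm_def, hs, ht]

variable [T2Space E]

theorem curveDeriv_iterate_plane (v w : E) (n : ℕ) : ∀ (x : E) {g h : ℝ → ℝ},
    ContDiff ℝ ∞ g → ContDiff ℝ ∞ h → ∃ (y : E) (g' h' : ℝ → ℝ), ContDiff ℝ ∞ g' ∧
      ContDiff ℝ ∞ h' ∧
      curveDeriv^[n] (fun s => x + g s • v + h s • w) = fun s => y + g' s • v + h' s • w := by
  induction n with
  | zero => exact fun x g h hg hh => ⟨x, g, h, hg, hh, rfl⟩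
  | succ n ih =>
    intro x g h hg hh
    rw [Function.iterate_succ_apply]
    have e : curveDeriv (fun s => x + g s • v + h s • w)
        = fun s => (0 : E) + deriv g s • v + deriv h s • w := by
      funext t
      rw [zero_add]
      exact (hasCurveDerivAt_plane x v w (hg.differentiable (by simp) t)
        (hh.differentiable (by simp) t)).curveDeriv_eq
    rw [e]
    exact ih 0 (contDiff_infty_iff_deriv.1 hg).2 (contDiff_infty_iff_deriv.1 hh).2

theorem smoothCurve_plane (x v w : E) {g h : ℝ → ℝ} (hg : ContDiff ℝ ∞ g)
    (hh : ContDiff ℝ ∞ h) : SmoothCurve fun s => x + g s • v + h s • w := by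
  intro n
  obtain ⟨y, g', h', hg', hh', e⟩ := curveDeriv_iterate_plane v w n x hg hh
  rw [e]
  refine ⟨Continuous.continuousOn ?_, fun t _ => ⟨_, hasCurveDerivAt_plane y v w
    (hg'.differentiable (by simp) t) (hh'.differentiable (by simp) t)⟩⟩
  have := hg'.continuous
  have := hh'.continuous
  fun_prop

/-- A smooth function `ℝ → ℝ` which is the identity near `0` and bounded by `ε`. -/
theorem exists_smooth_clamp {ε : ℝ} (hε : 0 < ε) : ∃ γ : ℝ → ℝ, ContDiff ℝ ∞ γ ∧
    (∀ t, |γ t| < ε) ∧ γ =ᶠ[𝓝 0] id := by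
  let χ : ContDiffBump (0 : ℝ) := ⟨ε / 2, ε, half_pos hε, half_lt_self hε⟩
  refine ⟨fun t => t * χ t, contDiff_id.mul χ.contDiff, fun t => ?_, ?_⟩
  · show |t * χ t| < ε
    rcases le_or_gt ε |t| with h | h
    · have h0 : χ t = 0 := χ.zero_of_le_dist (by simpa using h)
      simpa [h0] using hε
    · rw [abs_mul, abs_of_nonneg χ.nonneg]
      exact (mul_le_of_le_one_right (abs_nonneg t) χ.le_one).trans_lt h
  · filter_upwards [χ.eventuallyEq_one] with t ht
    simp [ht]

theorem SmoothMapOn.lineDeriv_add {f : E → ℝ} {U : Set E} (hf : SmoothMapOn f U)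
    (hU : IsOpen U) {x : E} (hx : x ∈ U) (v w : E) :
    lineDeriv ℝ f x (v + w) = lineDeriv ℝ f x v + lineDeriv ℝ f x w := by
  obtain ⟨ε, hε, hsub⟩ := exists_plane_subset hU hx v w
  obtain ⟨γ, hγ, hγε, hγ0⟩ := exists_smooth_clamp hε
  have h0 : γ 0 = 0 := hγ0.self_of_nhds
  have key := deriv_diag_of_smooth_along_curves (fun s t => f (x + γ s • v + γ t • w))
    fun g h hg hh => smoothCurve_real_iff.1 (hf _
      (smoothCurve_plane x v w (hγ.comp hg) (hγ.comp hh)) fun t => hsub _ _ (hγε _) (hγε _))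
  have e1 : (fun t => f (x + γ t • v + γ t • w)) =ᶠ[𝓝 0] fun t => f (x + t • (v + w)) := by
    filter_upwards [hγ0] with t ht
    rw [ht, id, smul_add, add_assoc]
  have e2 : (fun t => f (x + γ t • v + γ 0 • w)) =ᶠ[𝓝 0] fun t => f (x + t • v) := by
    filter_upwards [hγ0] with t ht
    rw [ht, id, h0, zero_smul, add_zero]
  have e3 : (fun t => f (x + γ 0 • v + γ t • w)) =ᶠ[𝓝 0] fun t => f (x + t • w) := by
    filter_upwards [hγ0] with t ht
    rw [ht, id, h0, zero_smul, add_zero]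
  rw [e1.deriv_eq, e2.deriv_eq, e3.deriv_eq] at key
  exact key

theorem SmoothMapOn.hasLineDerivAt {f : E → ℝ} {U : Set E} (hf : SmoothMapOn f U)
    (hU : IsOpen U) {x : E} (hx : x ∈ U) (v : E) :
    HasLineDerivAt ℝ f (lineDeriv ℝ f x v) x v := by
  obtain ⟨ε, hε, hsub⟩ := exists_plane_subset hU hx v 0
  obtain ⟨γ, hγ, hγε, hγ0⟩ := exists_smooth_clamp hε
  have h := smoothCurve_real_iff.1 (hf _ (smoothCurve_plane x v 0 hγ hγ)
    fun t => hsub _ _ (hγε _) (hγε _))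
  have e : (f ∘ fun t => x + γ t • v + γ t • (0 : E)) =ᶠ[𝓝 0] fun t => f (x + t • v) := by
    filter_upwards [hγ0] with t ht
    simp [ht]
  exact LineDifferentiableAt.hasLineDerivAt
    (((h.differentiable (by simp)) 0).congr_of_eventuallyEq e.symm)

end Curves

section Manifolds

variable (E : Type*) [AddCommGroup E] [Module ℝ E] [TopologicalSpace E]
  [IsTopologicalAddGroup E] [ContinuousSMul ℝ E] [T2Space E]

variable {E} in
/-- The value at `x` of the exterior derivative of a 1-form `ℓ` on an open subset `U` of `E`:
`(v, w) ↦ D_v (ℓ w) x - D_w (ℓ v) x`. -/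
noncomputable def localExtDeriv (ℓ : E → E →L[ℝ] ℝ) {U : Set E}
    (hℓ : ∀ v : E, SmoothMapOn (fun x => ℓ x v) U) (hU : IsOpen U) {x : E} (hx : x ∈ U) :
    E [⋀^Fin 2]→ₗ[ℝ] ℝ :=
  AlternatingMap.alternatizeUncurryFin
    { toFun := fun v => AlternatingMap.ofSubsingleton ℝ E ℝ (0 : Fin 1)
        { toFun := fun w => lineDeriv ℝ (fun y => ℓ y w) x v
          map_add' := fun w₁ w₂ => by
            have h := HasDerivAt.add ((hℓ w₁).hasLineDerivAt hU hx v)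
              ((hℓ w₂).hasLineDerivAt hU hx v)
            refine HasLineDerivAt.lineDeriv (𝕜 := ℝ) (h.congr_of_eventuallyEq ?_)
            exact Eventually.of_forall fun t => map_add (ℓ (x + t • v)) w₁ w₂
          map_smul' := fun a w => by
            have h := HasDerivAt.const_mul a ((hℓ w).hasLineDerivAt hU hx v)
            refine HasLineDerivAt.lineDeriv (𝕜 := ℝ) (h.congr_of_eventuallyEq ?_)
            exact Eventually.of_forall fun t => map_smul (ℓ (x + t • v)) a w }
      map_add' := fun v₁ v₂ => by
        ext u
        exact (hℓ (u 0)).lineDeriv_add hU hx v₁ v₂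
      map_smul' := fun a v => by
        ext u
        exact (lineDeriv_smul : lineDeriv ℝ (fun y => ℓ y (u 0)) x (a • v) =
          a • lineDeriv ℝ (fun y => ℓ y (u 0)) x v) }

variable {E} in
theorem localExtDeriv_apply (ℓ : E → E →L[ℝ] ℝ) {U : Set E}
    (hℓ : ∀ v : E, SmoothMapOn (fun x => ℓ x v) U) (hU : IsOpen U) {x : E} (hx : x ∈ U)
    (v w : E) : localExtDeriv ℓ hℓ hU hx ![v, w] =
      lineDeriv ℝ (fun y => ℓ y w) x v - lineDeriv ℝ (fun y => ℓ y v) x w := by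
  rw [localExtDeriv, AlternatingMap.alternatizeUncurryFin_apply, Fin.sum_univ_two]
  simp [Fin.removeNth, sub_eq_add_neg]

/-- `M`, with its atlas of charts with values in `E`, is a smooth manifold modelled by the
convenient space `E`: all coordinate changes are smooth. -/
class ConvenientManifold [LocallyConvexSpace ℝ E] [ConvenientSpace E] (M : Type*) [TopologicalSpace M] [ChartedSpace E M] : Prop where
  smooth_coordChange : ∀ φ ∈ atlas E M, ∀ ψ ∈ atlas E M,
    SmoothMapOn (φ.symm.trans ψ : E → E) (φ.symm.trans ψ).source

/-- The smooth paths `ℝ → M`. -/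
structure SmoothPath (M : Type*) [TopologicalSpace M] [ChartedSpace E M] where
  toFun : ℝ → M
  continuous_toFun : Continuous toFun
  smooth_toFun : ∀ φ ∈ atlas E M, SmoothCurveOn (φ ∘ toFun) (toFun ⁻¹' φ.source)

variable {E}
variable {M : Type*} [TopologicalSpace M] [ChartedSpace E M]

/-- `(φ ∘ c)' 0`, for a smooth path `c` in `M` and a chart `φ` around `c 0`. -/
noncomputable def SmoothPath.velocity (φ : OpenPartialHomeomorph M E) (c : SmoothPath E M) : E :=
  curveDeriv (φ ∘ c.toFun) 0

variable (E) in
/-- Smooth paths through `p` at time `0` are equivalent if they have the same velocity in a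
chart around `p`. -/
def pathSetoid (p : M) : Setoid {c : SmoothPath E M // c.toFun 0 = p} where
  r c b := c.1.velocity (chartAt E p) = b.1.velocity (chartAt E p)
  iseqv := ⟨fun _ => rfl, Eq.symm, Eq.trans⟩

variable (E) in
/-- The kinematic tangent space of `M` at `p`: equivalence classes of smooth paths. -/
def KinTangent (p : M) : Type _ := Quotient (pathSetoid E p)

/-- The tangent vector at time `0` of a smooth path. -/
def SmoothPath.tangent (c : SmoothPath E M) : KinTangent E (c.toFun 0) :=
  Quotient.mk (pathSetoid E (c.toFun 0)) ⟨c, rfl⟩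

variable [LocallyConvexSpace ℝ E] [ConvenientSpace E]

/-- In a chart, all velocities at a point are realised by smooth paths in `M`. -/
theorem exists_smoothPath [ConvenientManifold E M] {φ : OpenPartialHomeomorph M E}
    (hφ : φ ∈ atlas E M) {p : M} (hp : p ∈ φ.source) (v : E) :
    ∃ c : SmoothPath E M, c.toFun 0 = p ∧ c.velocity φ = v := by
  obtain ⟨ε, hε, hsub⟩ := exists_plane_subset φ.open_target (φ.map_source hp) v 0
  obtain ⟨γ, hγ, hγε, hγ0⟩ := exists_smooth_clamp hε
  let b : ℝ → E := fun t => φ p + γ t • v + γ t • (0 : E)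
  have hbt : ∀ t, b t ∈ φ.target := fun t => hsub _ _ (hγε t) (hγε t)
  have hbc : Continuous b := by
    have := hγ.continuous
    fun_prop
  have hcont : Continuous fun t => φ.symm (b t) :=
    φ.continuousOn_symm.comp_continuous hbc hbt
  refine ⟨⟨fun t => φ.symm (b t), hcont, fun ψ hψ => ?_⟩, ?_, ?_⟩
  · refine smoothCurveOn_of_local fun t₀ ht₀ => ?_
    -- reparametrise so that the whole curve stays in the domain of the coordinate change
    have hopen : IsOpen ((fun t => φ.symm (b t)) ⁻¹' ψ.source) := ψ.open_source.preimage hcont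
    obtain ⟨δ, hδ, hball⟩ := Metric.isOpen_iff.1 hopen t₀ ht₀
    obtain ⟨ρ, hρ, hρδ, hρ0⟩ := exists_smooth_clamp hδ
    have hθ : ContDiff ℝ ∞ fun t => γ (t₀ + ρ (t - t₀)) := by fun_prop
    refine ⟨_, ConvenientManifold.smooth_coordChange φ hφ ψ hψ _
      (smoothCurve_plane (φ p) v 0 hθ hθ) fun t => ?_, ?_⟩
    · rw [OpenPartialHomeomorph.trans_source]
      refine ⟨hbt _, ?_⟩
      have : t₀ + ρ (t - t₀) ∈ Metric.ball t₀ δ := by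
        simpa [Real.dist_eq] using hρδ (t - t₀)
      exact hball this
    · have ht : Tendsto (fun t : ℝ => t - t₀) (𝓝 t₀) (𝓝 0) := by
        have : Tendsto (fun t : ℝ => t - t₀) (𝓝 t₀) (𝓝 (t₀ - t₀)) :=
          (continuous_id.sub continuous_const).tendsto _
        rwa [sub_self] at this
      filter_upwards [ht.eventually hρ0] with t ht
      have e : t₀ + ρ (t - t₀) = t := by rw [ht, id]; ring
      simp only [Function.comp, e, b, OpenPartialHomeomorph.coe_trans]
  · have h0 : γ 0 = 0 := hγ0.self_of_nhds
    simp [b, h0, φ.left_inv hp]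
  · have e : φ ∘ (fun t => φ.symm (b t)) = b := by
      funext t
      exact φ.right_inv (hbt t)
    have h1 : deriv γ 0 = 1 := by rw [hγ0.deriv_eq]; exact deriv_id 0
    have hd := hγ.differentiable (by simp) 0
    show curveDeriv (φ ∘ fun t => φ.symm (b t)) 0 = v
    rw [e, (hasCurveDerivAt_plane (φ p) v 0 hd hd).curveDeriv_eq, h1, one_smul, smul_zero,
      add_zero]

variable [ConvenientManifold E M]

variable (E) in
/-- The bijection of the tangent space at `p` with the model space, given by the velocity in
the preferred chart at `p`. -/
noncomputable def tangentCoord (p : M) : KinTangent E p ≃ E :=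
  Equiv.ofBijective
    (Quotient.lift (fun c => c.1.velocity (chartAt E p)) fun _ _ h => h) <| by
      constructor
      · rintro ⟨c⟩ ⟨b⟩ h
        exact Quotient.sound h
      · intro v
        obtain ⟨c, hc, hv⟩ := exists_smoothPath (chart_mem_atlas E p) (mem_chart_source E p) v
        exact ⟨Quotient.mk _ ⟨c, hc⟩, hv⟩

noncomputable instance (p : M) : AddCommGroup (KinTangent E p) :=
  (tangentCoord E p).addCommGroup

noncomputable instance (p : M) : Module ℝ (KinTangent E p) :=
  (tangentCoord E p).module ℝ

variable (E) in
/-- The bijection `tangentCoord` as a linear equivalence. -/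
noncomputable def tangentCoordₗ (p : M) : KinTangent E p ≃ₗ[ℝ] E :=
  (tangentCoord E p).linearEquiv ℝ

/-- `ℓ` represents in the chart `φ` the family `η` of linear forms on the tangent spaces: `ℓ` is
a differential 1-form on the open subset `φ.target` of `E`, i.e. it is smooth in the point and
continuous and linear in the vector, and `η [c] = ℓ (φ (c 0)) ((φ ∘ c)' 0)`. -/
structure IsLocalRep (η : ∀ p : M, KinTangent E p →ₗ[ℝ] ℝ) (φ : OpenPartialHomeomorph M E)
    (ℓ : E → E →L[ℝ] ℝ) : Prop where
  smooth : ∀ v : E, SmoothMapOn (fun x => ℓ x v) φ.target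
  apply_tangent : ∀ c : SmoothPath E M, c.toFun 0 ∈ φ.source →
    η (c.toFun 0) c.tangent = ℓ (φ (c.toFun 0)) (c.velocity φ)

variable (E M) in
/-- Kinematic 1-forms on `M`. -/
structure OneForm where
  toFun : ∀ p : M, KinTangent E p →ₗ[ℝ] ℝ
  exists_localRep : ∀ φ ∈ atlas E M, ∃ ℓ : E → E →L[ℝ] ℝ, IsLocalRep toFun φ ℓ

namespace OneForm

variable (η : OneForm E M)

/-- The exterior derivative `dη` at the point `p`, computed in the preferred chart at `p`. -/
noncomputable def extDeriv (p : M) : KinTangent E p [⋀^Fin 2]→ₗ[ℝ] ℝ :=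
  (localExtDeriv _ (η.exists_localRep _ (chart_mem_atlas E p)).choose_spec.smooth
    (chartAt E p).open_target (mem_chart_target E p)).compLinearMap (tangentCoordₗ E p).toLinearMap

/-- The horizontal distribution `ker η`. -/
noncomputable def hor (p : M) : Submodule ℝ (KinTangent E p) :=
  LinearMap.ker (η.toFun p)

/-- The vertical distribution `ker dη`, the kernel of `v ↦ dη(v, -)`. -/
noncomputable def ver (p : M) : Submodule ℝ (KinTangent E p) :=
  LinearMap.ker (η.extDeriv p).curryLeft

/-- `η` is a (weakly) contact form: `dη` is degenerate (it has non-zero kernel at each point) and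
`TM` is the direct sum of the horizontal and the vertical distribution. -/
structure IsContact : Prop where
  degenerate : ∀ p : M, η.ver p ≠ ⊥
  isCompl : ∀ p : M, IsCompl (η.hor p) (η.ver p)

end OneForm

end Manifolds

section Wedge

variable {V : Type*} [AddCommGroup V] [Module ℝ V]

/-- The wedge product of alternating forms (the signed sum over shuffles). -/
noncomputable def wedge {m n : ℕ} (α : V [⋀^Fin m]→ₗ[ℝ] ℝ) (β : V [⋀^Fin n]→ₗ[ℝ] ℝ) :
    V [⋀^Fin (m + n)]→ₗ[ℝ] ℝ :=
  ((LinearMap.mul' ℝ ℝ).compAlternatingMap (α.domCoprod β)).domDomCongr finSumFinEquiv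

/-- The `k`-th wedge power of an alternating 2-form. -/
noncomputable def wedgePow (Ω : V [⋀^Fin 2]→ₗ[ℝ] ℝ) : (k : ℕ) → V [⋀^Fin (2 * k)]→ₗ[ℝ] ℝ
  | 0 => AlternatingMap.constOfIsEmpty ℝ V (Fin 0) 1
  | k + 1 => wedge (wedgePow Ω k) Ω

/-- A linear form as an alternating 1-form. -/
noncomputable def altOfLinear (f : V →ₗ[ℝ] ℝ) : V [⋀^Fin 1]→ₗ[ℝ] ℝ :=
  AlternatingMap.ofSubsingleton ℝ V ℝ 0 f

end Wedge

section

variable {E : Type*} [AddCommGroup E] [Module ℝ E] [TopologicalSpace E]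
  [IsTopologicalAddGroup E] [ContinuousSMul ℝ E] [T2Space E] [LocallyConvexSpace ℝ E]
  [ConvenientSpace E] {M : Type*} [TopologicalSpace M] [ChartedSpace E M] [ConvenientManifold E M]

/-- The differential form `η ∧ (dη)^k` of degree `1 + 2k` on `M`. -/
noncomputable def OneForm.wedgeExtDerivPow (η : OneForm E M) (k : ℕ) (p : M) :
    KinTangent E p [⋀^Fin (1 + 2 * k)]→ₗ[ℝ] ℝ :=
  wedge (altOfLinear (η.toFun p)) (wedgePow (η.extDeriv p) k)

end

end ConvenientGeometry

/-! The claim is pointwise linear algebra on $V=T_pM$, which is linearly isomorphic to $E$ and hence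
infinite-dimensional. Write $\alpha=\eta_p$ and $\Omega=d\eta_p$. As $\ker\Omega$ is non-zero and
meets $\ker\alpha$ trivially, some $r$ has $\alpha(r)>0$. The hyperplane $\ker\alpha$ is
infinite-dimensional, and $\Omega$ is non-degenerate on it: a vector of $\ker\alpha$ orthogonal to
$\ker\alpha$ is also orthogonal to the complement $\ker\Omega$, so it lies in
$\ker\alpha\cap\ker\Omega=0$. Symplectic Gram-Schmidt (`exists_isSymplecticFamily`) then gives, for
every $k$, $k$ mutually orthogonal hyperbolic pairs in $\ker\alpha$.

It remains to see that $\alpha\wedge\Omega^k$ is non-zero on $r$ followed by these pairs. By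
`wedge_alternatization` the iterated shuffle sums become one sum over all permutations of a product
of values of $\alpha$ and $\Omega$. No term is negative (`IsSymplecticFamily.sign_mul_prod_nonneg`)
and the identity contributes a positive one, so the exact value is never needed. -/

namespace ConvenientGeometry

/-! ### Hyperbolic pairs and the signs in the Pfaffian expansion -/

section SymplecticFamilies

variable {V : Type*} [AddCommGroup V] [Module ℝ V]

/-- The family `w` consists of pairwise orthogonal hyperbolic pairs for the bilinear form `B`. -/
def IsSymplecticFamily {ι : Type*} [DecidableEq ι] (B : V →ₗ[ℝ] V →ₗ[ℝ] ℝ) (w : ι × Fin 2 → V) :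
    Prop :=
  ∀ x y, B (w x) (w y) = if x.1 = y.1 then ((y.2 : ℕ) : ℝ) - ((x.2 : ℕ) : ℝ) else 0

/-- A non-zero vector orthogonal to finitely many vectors exists in infinite dimension. -/
theorem exists_ne_zero_orthogonal (B : V →ₗ[ℝ] V →ₗ[ℝ] ℝ) (H : Submodule ℝ V)
    (hH : ¬ FiniteDimensional ℝ H) {κ : Type*} [Finite κ] (w : κ → V) :
    ∃ e ∈ H, e ≠ 0 ∧ ∀ x, B (w x) e = 0 := by
  by_contra! hcon
  -- If only $0$ were orthogonal to the whole family, pairing with it would embed $H$ in the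
  -- finite-dimensional space $\mathbb{R}^\kappa$.
  refine hH (Module.Finite.of_injective (LinearMap.pi (fun x => (B (w x)).comp H.subtype)) ?_)
  rw [← LinearMap.ker_eq_bot, LinearMap.ker_eq_bot']
  intro v hv
  by_contra hne
  obtain ⟨x, hx⟩ := hcon v v.2 (fun h => hne (Subtype.ext h))
  exact hx (congrFun hv x)

/-- Symplectic Gram-Schmidt, adding one pair at a time. Infinite dimension supplies $e\neq0$ in $H$
orthogonal to the pairs already found, and non-degeneracy on $H$ supplies a partner $u$. Making $u$
orthogonal to the old pairs leaves $B(e,u)$ unchanged, so non-degeneracy is only ever used on $H$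
itself, never on an orthogonal complement. -/
theorem exists_isSymplecticFamily (B : V →ₗ[ℝ] V →ₗ[ℝ] ℝ) (hB : B.IsAlt) (H : Submodule ℝ V)
    (hH : ¬ FiniteDimensional ℝ H) (hnd : ∀ v ∈ H, (∀ u ∈ H, B v u = 0) → v = 0) (k : ℕ) :
    ∃ w : Fin k × Fin 2 → V, (∀ x, w x ∈ H) ∧ IsSymplecticFamily B w := by
  induction k with
  | zero => exact ⟨fun _ => 0, fun x => x.1.elim0, fun x => x.1.elim0⟩
  | succ k ih =>
    obtain ⟨w, hwH, hw⟩ := ih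
    have hsymm : ∀ u v, B u v = - B v u := fun u v => (hB.neg v u).symm
    obtain ⟨e, heH, he0, he⟩ := exists_ne_zero_orthogonal B H hH w
    obtain ⟨u, huH, hu⟩ : ∃ u ∈ H, B e u ≠ 0 := by
      by_contra! h
      exact he0 (hnd e heH h)
    -- Since $B(w_{i,0},w_{i,1})=1$, these coefficients subtract from $u$ its projection onto the
    -- span of the old pairs.
    let g : V := u + ∑ i, (B (w (i, 1)) u • w (i, 0) - B (w (i, 0)) u • w (i, 1))
    have hgH : g ∈ H := H.add_mem huH (H.sum_mem fun i _ =>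
      H.sub_mem (H.smul_mem _ (hwH _)) (H.smul_mem _ (hwH _)))
    have he' : ∀ x, B e (w x) = 0 := fun x => by rw [hsymm, he, neg_zero]
    have heg : B e g = B e u := by simp [g, he']
    have hwg : ∀ x, B (w x) g = 0 := by
      rintro ⟨j, a⟩
      simp only [g, map_add, map_sum, map_sub, map_smul, smul_eq_mul]
      rw [Finset.sum_eq_single j (fun i _ hi => by simp [hw _ _, hi.symm]) (by simp)]
      fin_cases a <;> simp [hw _ _]
    let f : V := (B e u)⁻¹ • g
    have hef : B e f = 1 := by simp [f, heg, hu]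
    have hwf : ∀ x, B (w x) f = 0 := fun x => by simp [f, hwg]
    have hfw : ∀ x, B f (w x) = 0 := fun x => by rw [hsymm, hwf, neg_zero]
    have hfe : B f e = -1 := by rw [hsymm, hef]
    refine ⟨fun x => Fin.cases (![e, f] x.2) (fun i => w (i, x.2)) x.1, ?_, ?_⟩
    · rintro ⟨i, a⟩
      refine Fin.cases ?_ (fun i => ?_) i
      · fin_cases a
        · exact heH
        · exact H.smul_mem _ hgH
      · exact hwH _
    · rintro ⟨i, a⟩ ⟨j, b⟩
      refine Fin.cases ?_ (fun i => ?_) i <;> refine Fin.cases ?_ (fun j => ?_) j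
      · fin_cases a <;> fin_cases b <;> simp [hB e, hB f, hef, hfe]
      · fin_cases a <;> simp [he', hfw, (Fin.succ_ne_zero j).symm]
      · fin_cases b <;> simp [he, hwf]
      · simpa using hw (i, a) (j, b)

/-- This is why `IsSymplecticFamily` records the value on a pair as a difference of labels:
permuting the two members by $\varepsilon$ gives exactly $\operatorname{sign}\varepsilon$. -/
theorem apply_perm_fin_two (ε : Equiv.Perm (Fin 2)) :
    (((ε 1 : Fin 2) : ℕ) : ℝ) - (((ε 0 : Fin 2) : ℕ) : ℝ) = ((Equiv.Perm.sign ε : ℤ) : ℝ) := by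
  have h : (((ε 1 : Fin 2) : ℕ) : ℤ) - (((ε 0 : Fin 2) : ℕ) : ℤ) = (Equiv.Perm.sign ε : ℤ) := by
    revert ε
    decide
  exact_mod_cast h

/-- All terms in the expansion of the Pfaffian of a symplectic family are non-negative. -/
theorem IsSymplecticFamily.sign_mul_prod_nonneg {ι : Type*} [DecidableEq ι] [Fintype ι]
    {B : V →ₗ[ℝ] V →ₗ[ℝ] ℝ} {w : ι × Fin 2 → V} (hw : IsSymplecticFamily B w)
    (σ : Equiv.Perm (ι × Fin 2)) :
    0 ≤ ((Equiv.Perm.sign σ : ℤ) : ℝ) * ∏ i, B (w (σ (i, 0))) (w (σ (i, 1))) := by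
  by_cases h0 : ∃ i, B (w (σ (i, 0))) (w (σ (i, 1))) = 0
  · obtain ⟨i, hi⟩ := h0
    rw [Finset.prod_eq_zero (Finset.mem_univ i) hi, mul_zero]
  push Not at h0
  -- In a non-vanishing term $\sigma$ must carry each pair onto a pair, because distinct pairs are
  -- orthogonal.
  have hfst : ∀ i, (σ (i, 0)).1 = (σ (i, 1)).1 := fun i => by
    by_contra h
    exact h0 i (by rw [hw, if_neg h])
  have hfst' : ∀ i a, (σ (i, a)).1 = (σ (i, 0)).1 := fun i a => by
    fin_cases a
    · rfl
    · exact (hfst i).symm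
  have hτ : Function.Bijective fun i => (σ (i, 0)).1 := by
    rw [← Finite.surjective_iff_bijective]
    intro j
    refine ⟨(σ.symm (j, 0)).1, ?_⟩
    show (σ ((σ.symm (j, 0)).1, 0)).1 = j
    rw [← hfst' _ (σ.symm (j, 0)).2]
    simp
  have hε : ∀ i, Function.Bijective fun a => (σ (i, a)).2 := fun i => by
    rw [← Finite.injective_iff_bijective]
    intro a b hab
    have : σ (i, a) = σ (i, b) := Prod.ext (by rw [hfst' i a, hfst' i b]) hab
    exact congrArg Prod.snd (σ.injective this)
  let τ : Equiv.Perm ι := Equiv.ofBijective _ hτ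
  let ε : ι → Equiv.Perm (Fin 2) := fun i => Equiv.ofBijective _ (hε i)
  -- Thus $\sigma$ first permutes inside each pair by $\varepsilon_i$, then moves whole pairs by
  -- $\tau$.
  have hσ : σ = Equiv.prodCongrLeft (fun _ : Fin 2 => τ) * Equiv.prodCongrRight ε := by
    ext1 ⟨i, a⟩
    exact Prod.ext (hfst' i a) rfl
  -- The permutation $\tau$ acts once for each of the two labels, so its sign enters squared and
  -- disappears.
  have hsign : Equiv.Perm.sign σ = ∏ i, Equiv.Perm.sign (ε i) := by
    rw [hσ, Equiv.Perm.sign_mul, Equiv.Perm.sign_prodCongrLeft, Equiv.Perm.sign_prodCongrRight]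
    simp
  have hterm : ∀ i, B (w (σ (i, 0))) (w (σ (i, 1))) = ((Equiv.Perm.sign (ε i) : ℤ) : ℝ) :=
    fun i => by
      rw [hw, if_pos (hfst i)]
      exact apply_perm_fin_two (ε i)
  simp only [hterm]
  have : ((Equiv.Perm.sign σ : ℤ) : ℝ) = ∏ i, ((Equiv.Perm.sign (ε i) : ℤ) : ℝ) := by
    rw [hsign]; push_cast; rfl
  -- The sign of $\sigma$ and the product of the values of $B$ are the same number
  -- $\prod_i\operatorname{sign}\varepsilon_i$, so the term is a square.
  rw [this]
  exact mul_self_nonneg _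

end SymplecticFamilies

/-! ### Wedge products as alternatizations of tensor products -/

section WedgeOfAlternatizations

variable {V : Type*} [AddCommGroup V] [Module ℝ V]

theorem alternatization_domDomCongr {ι κ N : Type*} [Fintype ι] [DecidableEq ι] [Fintype κ]
    [DecidableEq κ] [AddCommGroup N] [Module ℝ N] (e : ι ≃ κ)
    (P : MultilinearMap ℝ (fun _ : ι => V) N) :
    MultilinearMap.alternatization (P.domDomCongr e) =
      (MultilinearMap.alternatization P).domDomCongr e := by
  ext v
  rw [AlternatingMap.domDomCongr_apply, MultilinearMap.alternatization_apply,
    MultilinearMap.alternatization_apply]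
  refine (Fintype.sum_equiv e.permCongr _ _ fun σ => ?_).symm
  rw [Equiv.Perm.sign_permCongr]
  simp [MultilinearMap.domDomCongr_apply]

/-- The product of two multilinear forms in separate variables. -/
noncomputable def tensorForm {m n : ℕ} (P : MultilinearMap ℝ (fun _ : Fin m => V) ℝ)
    (Q : MultilinearMap ℝ (fun _ : Fin n => V) ℝ) :
    MultilinearMap ℝ (fun _ : Fin (m + n) => V) ℝ :=
  ((LinearMap.mul' ℝ ℝ).compMultilinearMap (P.domCoprod Q)).domDomCongr finSumFinEquiv

theorem tensorForm_apply {m n : ℕ} (P : MultilinearMap ℝ (fun _ : Fin m => V) ℝ)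
    (Q : MultilinearMap ℝ (fun _ : Fin n => V) ℝ) (v : Fin (m + n) → V) :
    tensorForm P Q v = P (fun i => v (finSumFinEquiv (.inl i))) *
      Q (fun i => v (finSumFinEquiv (.inr i))) := by
  simp [tensorForm, MultilinearMap.domCoprod_apply]

/-- Alternatization here is the unnormalised signed sum. The two factors therefore supply the sum
over $S_m\times S_n$, the shuffles supply its cosets in $S_{m+n}$, and no factorials appear. -/
theorem wedge_alternatization {m n : ℕ} (P : MultilinearMap ℝ (fun _ : Fin m => V) ℝ)
    (Q : MultilinearMap ℝ (fun _ : Fin n => V) ℝ) :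
    wedge (MultilinearMap.alternatization P) (MultilinearMap.alternatization Q) =
      MultilinearMap.alternatization (tensorForm P Q) := by
  rw [tensorForm, alternatization_domDomCongr, LinearMap.compMultilinearMap_alternatization,
    MultilinearMap.domCoprod_alternization, wedge]

/-- Iterates `wedge_alternatization`. The bijection `e` keeps the pairing of the $2k$ arguments
visible; only the product formula for `P` is used later, so which positions form a pair is
irrelevant. -/
theorem exists_wedgePow_eq_alternatization (β : MultilinearMap ℝ (fun _ : Fin 2 => V) ℝ) (k : ℕ) :
    ∃ (P : MultilinearMap ℝ (fun _ : Fin (2 * k) => V) ℝ) (e : Fin k × Fin 2 ≃ Fin (2 * k)),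
      wedgePow (MultilinearMap.alternatization β) k = MultilinearMap.alternatization P ∧
      ∀ v, P v = ∏ i, β fun a => v (e (i, a)) := by
  induction k with
  | zero =>
    have : IsEmpty (Fin (2 * 0)) := inferInstanceAs (IsEmpty (Fin 0))
    refine ⟨MultilinearMap.constOfIsEmpty ℝ _ 1, Equiv.equivOfIsEmpty _ _, ?_, fun v => by simp⟩
    ext v
    rw [MultilinearMap.alternatization_apply]
    simp [wedgePow]
  | succ k ih =>
    obtain ⟨P, e, hP, he⟩ := ih
    -- Split off the last pair and distribute: the first $k$ pairs are placed by `e`, and the last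
    -- one fills the two slots of the new factor.
    let e' : Fin (k + 1) × Fin 2 ≃ Fin (2 * k + 2) :=
      (Equiv.prodCongrLeft fun _ => finSumFinEquiv.symm).trans
        ((Equiv.sumProdDistrib _ _ _).trans
          ((Equiv.sumCongr e (Equiv.uniqueProd (Fin 2) (Fin 1))).trans finSumFinEquiv))
    refine ⟨tensorForm P β, e', ?_, fun v => ?_⟩
    · rw [wedgePow, hP, wedge_alternatization]
    · rw [tensorForm_apply, he, Fin.prod_univ_castSucc]
      have h1 : ∀ i a, e' (Fin.castSucc i, a) = finSumFinEquiv (.inl (e (i, a))) := fun i a => by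
        have : finSumFinEquiv.symm (Fin.castSucc i) = Sum.inl i :=
          finSumFinEquiv_symm_apply_castAdd i
        simp [e', this]
      have h2 : ∀ a, e' (Fin.last k, a) = finSumFinEquiv (.inr a) := fun a => by
        have : finSumFinEquiv.symm (Fin.last k) = Sum.inr (0 : Fin 1) :=
          finSumFinEquiv_symm_apply_natAdd (0 : Fin 1)
        simp [e', this]
      simp only [h1, h2]

end WedgeOfAlternatizations

/-! ### Non-vanishing of the wedge product -/

section WedgeNeZero

variable {V : Type*} [AddCommGroup V] [Module ℝ V]

/-- An alternating 2-form as a bilinear map. -/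
noncomputable def bilinOfAlt (Ω : V [⋀^Fin 2]→ₗ[ℝ] ℝ) : V →ₗ[ℝ] V →ₗ[ℝ] ℝ :=
  LinearMap.mk₂ ℝ (fun u v => Ω ![u, v])
    (fun u u' v => Ω.map_vecCons_add ![v] u u')
    (fun c u v => Ω.map_vecCons_smul ![v] c u)
    (fun u v v' => (Ω.curryLeft u).map_vecCons_add ![] v v')
    (fun c u v => (Ω.curryLeft u).map_vecCons_smul ![] c v)

theorem bilinOfAlt_apply (Ω : V [⋀^Fin 2]→ₗ[ℝ] ℝ) (u v : V) : bilinOfAlt Ω u v = Ω ![u, v] :=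
  rfl

theorem bilinOfAlt_isAlt (Ω : V [⋀^Fin 2]→ₗ[ℝ] ℝ) : (bilinOfAlt Ω).IsAlt := fun v =>
  Ω.map_eq_zero_of_eq ![v, v] (i := 0) (j := 1) rfl (by decide)

/-- Alternatizing an alternating 2-form multiplies it by $2!$, which the factor $1/2$ undoes. -/
theorem alternatization_half (Ω : V [⋀^Fin 2]→ₗ[ℝ] ℝ) :
    MultilinearMap.alternatization
      (((1 / 2 : ℝ) • Ω : V [⋀^Fin 2]→ₗ[ℝ] ℝ) : MultilinearMap ℝ (fun _ : Fin 2 => V) ℝ) = Ω := by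
  rw [AlternatingMap.coe_alternatization]
  ext v
  simp

theorem alternatization_altOfLinear (α : V →ₗ[ℝ] ℝ) :
    MultilinearMap.alternatization
      (altOfLinear α : MultilinearMap ℝ (fun _ : Fin 1 => V) ℝ) = altOfLinear α := by
  rw [AlternatingMap.coe_alternatization]
  simp

/-- Evaluate on $r$ followed by the family. Terms with a family vector in the slot of $\alpha$
vanish, so $r$ need not lie in $\ker\Omega$; the others are non-negative multiples of Pfaffian
terms. -/
theorem wedge_wedgePow_ne_zero (α : V →ₗ[ℝ] ℝ) (Ω : V [⋀^Fin 2]→ₗ[ℝ] ℝ) {r : V} (hr : 0 < α r)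
    {k : ℕ} {w : Fin k × Fin 2 → V} (hα : ∀ x, α (w x) = 0)
    (hw : IsSymplecticFamily (bilinOfAlt Ω) w) :
    wedge (altOfLinear α) (wedgePow Ω k) ≠ 0 := by
  obtain ⟨P, e, hP, he⟩ := exists_wedgePow_eq_alternatization
    (((1 / 2 : ℝ) • Ω : V [⋀^Fin 2]→ₗ[ℝ] ℝ) : MultilinearMap ℝ (fun _ : Fin 2 => V) ℝ) k
  rw [alternatization_half] at hP
  have hPv : ∀ v, P v = (1 / 2) ^ k * ∏ i, bilinOfAlt Ω (v (e (i, 0))) (v (e (i, 1))) := by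
    intro v
    have hpair : ∀ i, (fun a => v (e (i, a))) = ![v (e (i, 0)), v (e (i, 1))] := fun i => by
      ext1 a; fin_cases a <;> rfl
    rw [he]
    simp only [hpair, bilinOfAlt_apply]
    simp [Finset.prod_mul_distrib]
  rw [hP, ← alternatization_altOfLinear, wedge_alternatization]
  -- The family is placed through `e`, so that for $\sigma=1$ each factor of `P` receives one
  -- hyperbolic pair.
  let y : Fin 1 ⊕ Fin (2 * k) → V := Sum.elim (fun _ => r) (w ∘ e.symm)
  let t : Equiv.Perm (Fin 1 ⊕ Fin (2 * k)) → ℝ := fun σ => ((Equiv.Perm.sign σ : ℤ) : ℝ) *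
    (α (y (σ (.inl 0))) * P fun i => y (σ (.inr i)))
  have hsum : MultilinearMap.alternatization
      (tensorForm (altOfLinear α : MultilinearMap ℝ (fun _ : Fin 1 => V) ℝ) P)
      (y ∘ finSumFinEquiv.symm) = ∑ σ, t σ := by
    rw [MultilinearMap.alternatization_apply]
    refine (Fintype.sum_equiv finSumFinEquiv.permCongr _ _ fun σ => ?_).symm
    rw [Equiv.Perm.sign_permCongr, MultilinearMap.domDomCongr_apply, tensorForm_apply,
      Units.smul_def, zsmul_eq_mul]
    simp [t, altOfLinear]
  have hnonneg : ∀ σ, 0 ≤ t σ := by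
    intro σ
    rcases hσ : σ (.inl 0) with a | j
    · have hmem : σ ∈ (Equiv.Perm.sumCongrHom (Fin 1) (Fin (2 * k))).range := by
        refine Equiv.Perm.mem_sumCongrHom_range_of_perm_mapsTo_inl ?_
        rintro _ ⟨b, rfl⟩
        exact ⟨a, by rw [Subsingleton.elim b 0, hσ]⟩
      obtain ⟨⟨σ₁, σ₂⟩, rfl⟩ := hmem
      have h := mul_nonneg (mul_nonneg hr.le (by positivity : (0 : ℝ) ≤ (1 / 2) ^ k))
        (hw.sign_mul_prod_nonneg (e.symm.permCongr σ₂))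
      rw [Equiv.Perm.sign_permCongr] at h
      refine h.trans_eq ?_
      rw [Subsingleton.elim σ₁ 1]
      simp only [t, hPv, Equiv.Perm.sumCongrHom_apply, Equiv.Perm.sign_sumCongr]
      simp [y]
      ring
    · simp [t, hσ, y, hα]
  -- The identity contributes $\alpha(r)/2^k$.
  have hone : 0 < t 1 := by
    have : ∀ i, bilinOfAlt Ω (w (i, 0)) (w (i, 1)) = 1 := fun i => by simp [hw _ _]
    simp only [t, hPv]
    simp [y, this, hr]
  intro h0
  have : ∑ σ, t σ = 0 := by rw [← hsum, h0, AlternatingMap.zero_apply]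
  exact (Finset.sum_pos' (fun σ _ => hnonneg σ) ⟨1, Finset.mem_univ _, hone⟩).ne' this

/-- The linear algebra of contact forms on an infinite-dimensional vector space. -/
theorem wedge_wedgePow_ne_zero_of_isCompl (hV : ¬ FiniteDimensional ℝ V) (α : V →ₗ[ℝ] ℝ)
    (Ω : V [⋀^Fin 2]→ₗ[ℝ] ℝ) (hΩ : LinearMap.ker Ω.curryLeft ≠ ⊥)
    (hc : IsCompl (LinearMap.ker α) (LinearMap.ker Ω.curryLeft)) (k : ℕ) :
    wedge (altOfLinear α) (wedgePow Ω k) ≠ 0 := by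
  obtain ⟨r₀, hr₀, hne⟩ := Submodule.exists_mem_ne_zero_of_ne_bot hΩ
  have hαr₀ : α r₀ ≠ 0 := fun h => hne (Submodule.disjoint_def.1 hc.disjoint r₀ h hr₀)
  -- Rescaling by $\alpha(r_0)$ turns the value into $\alpha(r_0)^2$, fixing its sign.
  have hr : 0 < α (α r₀ • r₀) := by
    rw [map_smul, smul_eq_mul]
    exact mul_self_pos.2 hαr₀
  -- The quotient by $\ker\alpha$ is isomorphic to the range of $\alpha$ in $\mathbb{R}$, so a
  -- finite-dimensional kernel would make $V$ finite-dimensional.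
  have hfin : ¬ FiniteDimensional ℝ (LinearMap.ker α) := fun h => by
    have : Module.Finite ℝ (V ⧸ LinearMap.ker α) :=
      Module.Finite.equiv α.quotKerEquivRange.symm
    exact hV (Module.Finite.of_submodule_quotient (LinearMap.ker α))
  have hnd : ∀ v ∈ LinearMap.ker α, (∀ u ∈ LinearMap.ker α, bilinOfAlt Ω v u = 0) → v = 0 := by
    intro v hv h
    refine Submodule.disjoint_def.1 hc.disjoint v hv ?_
    rw [LinearMap.mem_ker]
    ext u
    have hu : u = ![u 0] := by ext1 i; rw [Subsingleton.elim i 0]; rfl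
    -- Split the test vector along the direct sum: the horizontal part pairs to zero by assumption,
    -- the vertical part because it lies in $\ker\Omega$.
    obtain ⟨x, hx, z, hz, hxz⟩ := Submodule.mem_sup.1
      (hc.sup_eq_top ▸ Submodule.mem_top : u 0 ∈ LinearMap.ker α ⊔ LinearMap.ker Ω.curryLeft)
    have hzv : bilinOfAlt Ω v z = 0 := by
      rw [← (bilinOfAlt_isAlt Ω).neg, neg_eq_zero]
      exact congrArg (fun f : V [⋀^Fin 1]→ₗ[ℝ] ℝ => f ![v]) (LinearMap.mem_ker.1 hz)
    have : bilinOfAlt Ω v (u 0) = 0 := by rw [← hxz, map_add, h x hx, hzv, add_zero]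
    rw [hu]
    exact this
  obtain ⟨w, hwH, hw⟩ := exists_isSymplecticFamily _ (bilinOfAlt_isAlt Ω) _ hfin hnd k
  exact wedge_wedgePow_ne_zero α Ω hr hwH hw

end WedgeNeZero

end ConvenientGeometry

theorem mainTheorem2 {E : Type*} [AddCommGroup E] [Module ℝ E] [TopologicalSpace E]
    [IsTopologicalAddGroup E] [ContinuousSMul ℝ E] [T2Space E] [LocallyConvexSpace ℝ E]
    [ConvenientGeometry.ConvenientSpace E] (hE : ¬ FiniteDimensional ℝ E)
    {M : Type*} [TopologicalSpace M] [ChartedSpace E M]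
    [ConvenientGeometry.ConvenientManifold E M]
    (η : ConvenientGeometry.OneForm E M) (hη : η.IsContact) :
    ∀ (k : ℕ) (p : M), η.wedgeExtDerivPow k p ≠ 0 := by
  intro k p
  refine ConvenientGeometry.wedge_wedgePow_ne_zero_of_isCompl (fun h => hE ?_) (η.toFun p)
    (η.extDeriv p) (hη.degenerate p) (hη.isCompl p) k
  exact Module.Finite.equiv (ConvenientGeometry.tangentCoordₗ E p)
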